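/- Let $\mathbb F$ be an algebraically closed field, let $d\ge 3$ be an integer, and let $V$ be a vector space over $\mathbb F$ of dimension $d+1$. **Leonard systems.** A square matrix is *irreducible tridiagonal* if its entries at distance more than one from the diagonal are zero and its entries at distance exactly one from the diagonal are nonzero. A *Leonard pair* on $V$ is an ordered pair $A,A^*\in\mathrm{End}(V)$ such that (i) there is a basis of $V$ with respect to which the matrix representing $A$ is irreducible tridiagonal and the matrix representing $A^*$ is diagonal; (ii) there is a basis of $V$ with respect to which the matrix representing $A^*$ is irreducible tridiagonal and the matrix representing $A$ is diagonal. For a Leonard pair $A,A^*$, each of $A,A^*$ is diagonalizable with one-dimensional eigenspaces. An ordering $\{\theta_i\}_{i=0}^d$ of the eigenvalues of $A$ is *standard* if corresponding eigenvectors form a basis as in (ii); an ordering $\{\theta^*_i\}_{i=0}^d$ of the eigenvalues of $A^*$ is *standard* if corresponding eigenvectors form a basis as in (i). The primitive idempotent $E_i$ (resp. $E^*_i$) is the projection onto the $\theta_i$-eigenspace of $A$ (resp. the $\theta^*_i$-eigenspace of $A^*$) along the sum of the other eigenspaces. A *Leonard system* on $V$ is a sequence $\Phi=(A;\{E_i\}_{i=0}^d;A^*;\{E^*_i\}_{i=0}^d)$,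 where $A,A^*$ is a Leonard pair on $V$ and where $\{E_i\}$, $\{E_i^*\}$ are the primitive idempotents of $A$, $A^*$ associated with standard orderings $\{\theta_i\}$, $\{\theta^*_i\}$ of their eigenvalues. **Split sequences.** For $0\ne u\in E^*_0V$ the vectors $u_i=(A-\theta_0I)(A-\theta_1I)\cdots(A-\theta_{i-1}I)u$ $(0\le i\le d)$ form a basis of $V$. For $1\le i\le d$ let $\varphi_i$ be the $(i-1,i)$-entry of the matrix representing $A^*$ with respect to this basis (rows and columns indexed by $0,\dots,d$); it does not depend on $u$. The sequence $\{\varphi_i\}_{i=1}^d$ is the *first split sequence* of $\Phi$. The *second split sequence* $\{\phi_i\}_{i=1}^d$ of $\Phi$ is the first split sequence of the Leonard system $(A;\{E_{d-i}\}_{i=0}^d;A^*;\{E^*_i\}_{i=0}^d)$. **Zero diagonal space.** Let $\mathcal X(\Phi)$ be the set of $X\in\mathrm{End}(V)$ such that $E_iXE_j=0$ and $E^*_iXE^*_j=0$ whenever $|i-j|>1$ $(0\le i,j\le d)$. An element $X\in\mathcal X(\Phi)$ *has zero diagonal* if $E^*_iXE^*_i=0$ for $0\le i\le d$. The *zero diagonal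 space* $\mathcal Z(\Phi)$ is the subspace of elements of $\mathrm{Span}\{I,A^*,A,AA^*\}$ that have zero diagonal. **Types.** * $\Phi$ has *dual $q$-Krawtchouk type* if there are nonzero $q,h,h^*,s\in\mathbb F$ with $q^i\ne1$ for $1\le i\le d$ and $sq^i\neq1$ for $2\le i\le 2d$ such that $\theta_i=\theta_0+h(1-q^i)(1-sq^{i+1})q^{-i}$ and $\theta^*_i=\theta^*_0+h^*(1-q^i)q^{-i}$ for $0\le i\le d$, and $\varphi_i=hh^*q^{1-2i}(1-q^i)(1-q^{i-d-1})$ and $\phi_i=hh^*sq^{d+2-2i}(1-q^i)(1-q^{i-d-1})$ for $1\le i\le d$. * $\Phi$ has *Hahn type* if the characteristic of $\mathbb F$ is $0$ or a prime greater than $d$, and there are $h^*,s,s^*,r\in\mathbb F$ with $h^*\neq0$, $s\ne0$, with neither of $r,\,s^*-r$ equal to $-i$ for $1\le i\le d$, and with $s^*\ne-i$ for $2\le i\le 2d$, such that $\theta_i=\theta_0+si$ and $\theta^*_i=\theta^*_0+h^*i(i+1+s^*)$ for $0\le i\le d$, and $\varphi_i=h^*si(i-d-1)(i+r)$ and $\phi_i=-h^*si(i-d-1)(i+s^*-r)$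 for $1\le i\le d$. * $\Phi$ has *Krawtchouk type* if the characteristic of $\mathbb F$ is $0$ or a prime greater than $d$, and there are nonzero $s,s^*,r\in\mathbb F$ with $r\ne ss^*$ such that $\theta_i=\theta_0+si$ and $\theta^*_i=\theta^*_0+s^*i$ for $0\le i\le d$, and $\varphi_i=ri(i-d-1)$ and $\phi_i=(r-ss^*)i(i-d-1)$ for $1\le i\le d$. **Theorem.** If a Leonard system $\Phi$ on $V$ has dual $q$-Krawtchouk, Hahn, or Krawtchouk type, then $\mathcal Z(\Phi)\ne0$. -/

import Mathlib

section Preliminaries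

variable {F V : Type*} [Field F] [AddCommGroup V] [Module F V] {d : ℕ}

/-- A square matrix, with rows and columns indexed by `0, …, d`, is irreducible tridiagonal: the
entries at distance more than one from the diagonal vanish, and the entries at distance exactly one
from the diagonal are nonzero. -/
def IsIrreducibleTridiagonal (M : Matrix (Fin (d + 1)) (Fin (d + 1)) F) : Prop :=
  (∀ i j : Fin (d + 1), 1 < |(i : ℤ) - (j : ℤ)| → M i j = 0) ∧
    (∀ i j : Fin (d + 1), |(i : ℤ) - (j : ℤ)| = 1 → M i j ≠ 0)

/-- `A, Astar` is a Leonard pair on `V`, where `V` has dimension `d + 1`. (The existence of a basis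
indexed by `Fin (d + 1)` says that `V` has this finite positive dimension.) -/
def IsLeonardPair (d : ℕ) (A Astar : Module.End F V) : Prop :=
  (∃ b : Module.Basis (Fin (d + 1)) F V,
    IsIrreducibleTridiagonal (LinearMap.toMatrix b b A) ∧ (LinearMap.toMatrix b b Astar).IsDiag) ∧
  (∃ b : Module.Basis (Fin (d + 1)) F V,
    IsIrreducibleTridiagonal (LinearMap.toMatrix b b Astar) ∧ (LinearMap.toMatrix b b A).IsDiag)

/-- `θ 0, …, θ d` is a standard ordering of the eigenvalues of `A`, relative to `B`: it is an
ordering (without repetition) of the eigenvalues of `A`, and some corresponding eigenvectors of `A`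
form a basis of `V` with respect to which the matrix representing `B` is irreducible tridiagonal. -/
structure IsStandardOrdering (A B : Module.End F V) (θ : Fin (d + 1) → F) : Prop where
  injective : Function.Injective θ
  hasEigenvalue_iff : ∀ μ : F, A.HasEigenvalue μ ↔ ∃ i, θ i = μ
  exists_basis : ∃ b : Module.Basis (Fin (d + 1)) F V,
    (∀ i, A (b i) = θ i • b i) ∧ IsIrreducibleTridiagonal (LinearMap.toMatrix b b B)

/-- `E i` is the primitive idempotent of `A` associated with the eigenvalue `θ i`, for all `i`:
it is the identity on the `θ i`-eigenspace and vanishes on the other eigenspaces. -/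
def IsPrimitiveIdempotents (A : Module.End F V) (θ : Fin (d + 1) → F)
    (E : Fin (d + 1) → Module.End F V) : Prop :=
  ∀ i, (∀ v ∈ A.eigenspace (θ i), E i v = v) ∧ ∀ j, j ≠ i → ∀ v ∈ A.eigenspace (θ j), E i v = 0

/-- The polynomial `(x - θ 0) (x - θ 1) ⋯ (x - θ (i - 1))`. -/
noncomputable def tauPoly (θ : Fin (d + 1) → F) (i : Fin (d + 1)) : Polynomial F :=
  ∏ j ∈ Finset.Iio i, (Polynomial.X - Polynomial.C (θ j))

theorem IsIrreducibleTridiagonal.submatrix_rev {M : Matrix (Fin (d + 1)) (Fin (d + 1)) F}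
    (h : IsIrreducibleTridiagonal M) :
    IsIrreducibleTridiagonal (M.submatrix Fin.rev Fin.rev) := by
  have key : ∀ i j : Fin (d + 1),
      |((Fin.rev i : Fin (d + 1)) : ℤ) - ((Fin.rev j : Fin (d + 1)) : ℤ)| = |(i : ℤ) - (j : ℤ)| := by
    intro i j
    rw [abs_sub_comm (i : ℤ)]
    congr 1
    simp only [Fin.val_rev]
    omega
  exact ⟨fun i j hij => h.1 _ _ (by rw [key]; exact hij),
    fun i j hij => h.2 _ _ (by rw [key]; exact hij)⟩

theorem IsStandardOrdering.rev {A B : Module.End F V} {θ : Fin (d + 1) → F}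
    (h : IsStandardOrdering A B θ) : IsStandardOrdering A B (fun i => θ (Fin.rev i)) where
  injective := h.injective.comp Fin.rev_injective
  hasEigenvalue_iff μ := by
    rw [h.hasEigenvalue_iff]
    exact ⟨fun ⟨i, hi⟩ => ⟨Fin.rev i, by simpa using hi⟩, fun ⟨i, hi⟩ => ⟨Fin.rev i, hi⟩⟩
  exists_basis := by
    obtain ⟨b, hb, ht⟩ := h.exists_basis
    refine ⟨b.reindex Fin.revPerm, fun i => by simpa using hb (Fin.rev i), ?_⟩
    have : LinearMap.toMatrix (b.reindex Fin.revPerm) (b.reindex Fin.revPerm) B =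
        (LinearMap.toMatrix b b B).submatrix Fin.rev Fin.rev := by
      ext i j
      simp [LinearMap.toMatrix_apply]
    rw [this]
    exact ht.submatrix_rev

theorem IsPrimitiveIdempotents.rev {A : Module.End F V} {θ : Fin (d + 1) → F}
    {E : Fin (d + 1) → Module.End F V} (h : IsPrimitiveIdempotents A θ E) :
    IsPrimitiveIdempotents A (fun i => θ (Fin.rev i)) (fun i => E (Fin.rev i)) :=
  fun i => ⟨(h (Fin.rev i)).1,
    fun j hj => (h (Fin.rev i)).2 (Fin.rev j) (fun e => hj (Fin.rev_injective e))⟩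

end Preliminaries

/-- A Leonard system `Φ = (A; {E i}; Astar; {Estar i})` of diameter `d` on `V`. The eigenvalue
sequence `θ` and the dual eigenvalue sequence `θstar` are determined by the other data, and they are
recorded for convenience: `θ i` (resp. `θstar i`) is the eigenvalue of `A` (resp. `Astar`) associated
with the primitive idempotent `E i` (resp. `Estar i`). -/
structure LeonardSystem (F V : Type*) [Field F] [AddCommGroup V] [Module F V] (d : ℕ) where
  A : Module.End F V
  E : Fin (d + 1) → Module.End F V
  Astar : Module.End F V
  Estar : Fin (d + 1) → Module.End F V
  θ : Fin (d + 1) → F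
  θstar : Fin (d + 1) → F
  isLeonardPair : IsLeonardPair d A Astar
  standard : IsStandardOrdering A Astar θ
  idempotents : IsPrimitiveIdempotents A θ E
  standard_star : IsStandardOrdering Astar A θstar
  idempotents_star : IsPrimitiveIdempotents Astar θstar Estar

namespace LeonardSystem

variable {F V : Type*} [Field F] [AddCommGroup V] [Module F V] {d : ℕ}

/-- The Leonard system `Φ^⇓ = (A; {E (d - i)}; Astar; {Estar i})`. -/
def invert (Φ : LeonardSystem F V d) : LeonardSystem F V d where
  A := Φ.A
  E i := Φ.E (Fin.rev i)
  Astar := Φ.Astar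
  Estar := Φ.Estar
  θ i := Φ.θ (Fin.rev i)
  θstar := Φ.θstar
  isLeonardPair := Φ.isLeonardPair
  standard := Φ.standard.rev
  idempotents := Φ.idempotents.rev
  standard_star := Φ.standard_star
  idempotents_star := Φ.idempotents_star

/-- The basis `b` of `V` is `Φ`-split: there is a nonzero `u` in `Estar 0 V` such that
`b i = τ_i(A) u` for all `i`, where `τ_i(x) = (x - θ 0) ⋯ (x - θ (i - 1))`. -/
def IsSplitBasis (Φ : LeonardSystem F V d) (b : Module.Basis (Fin (d + 1)) F V) : Prop :=
  ∃ u ∈ LinearMap.range (Φ.Estar 0), u ≠ 0 ∧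
    ∀ i, b i = Polynomial.aeval Φ.A (tauPoly Φ.θ i) u

theorem exists_isSplitBasis (Φ : LeonardSystem F V d) : ∃ b, Φ.IsSplitBasis b := by
  obtain ⟨e, he, ht⟩ := Φ.standard_star.exists_basis
  set w : Fin (d + 1) → V := fun i => Polynomial.aeval Φ.A (tauPoly Φ.θ i) (e 0) with hw
  have hw0 : w 0 = e 0 := by
    have : Finset.Iio (0 : Fin (d + 1)) = ∅ := by ext j; simp
    simp [hw, tauPoly, this]
  have hws : ∀ i : Fin d, w i.succ = Φ.A (w i.castSucc) - Φ.θ i.castSucc • w i.castSucc := by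
    intro i
    have h1 : Finset.Iio i.succ = insert i.castSucc (Finset.Iio i.castSucc) := by
      ext j
      simp only [Finset.mem_Iio, Finset.mem_insert, Fin.lt_def, Fin.ext_iff, Fin.val_succ,
        Fin.val_castSucc]
      omega
    simp only [hw, tauPoly]
    rw [h1, Finset.prod_insert (by simp)]
    simp [sub_mul, Algebra.algebraMap_eq_smul_one]
  -- coordinates of `A v` in the basis `e`
  have hA : ∀ (v : V) (k : Fin (d + 1)),
      e.repr (Φ.A v) k = ∑ j, LinearMap.toMatrix e e Φ.A k j * e.repr v j := by
    intro v k
    have := LinearMap.toMatrix_mulVec_repr e e Φ.A v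
    rw [← this]
    rfl
  have main : ∀ i : Fin (d + 1), e.repr (w i) i ≠ 0 ∧ ∀ k, i < k → e.repr (w i) k = 0 := by
    intro i
    induction i using Fin.induction with
    | zero =>
      rw [hw0]
      refine ⟨by simp, fun k hk => ?_⟩
      simp [hk.ne]
    | succ i ih =>
      obtain ⟨ih1, ih2⟩ := ih
      rw [hws]
      refine ⟨?_, fun k hk => ?_⟩
      · rw [map_sub, map_smul, Finsupp.sub_apply, Finsupp.smul_apply, ih2 i.succ (by simp [Fin.lt_def]),
          smul_zero, sub_zero, hA, Finset.sum_eq_single i.castSucc]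
        · exact mul_ne_zero (ht.2 _ _ (by simp)) ih1
        · intro j _ hj
          rcases lt_or_gt_of_ne hj with h | h
          · rw [ht.1, zero_mul]
            rw [Fin.lt_def] at h
            rw [lt_abs]
            left
            simp only [Fin.val_succ, Fin.val_castSucc] at h ⊢
            omega
          · rw [ih2 j h, mul_zero]
        · simp
      · have hk' : (i : ℕ) + 1 < k := by simpa [Fin.lt_def] using hk
        rw [map_sub, map_smul, Finsupp.sub_apply, Finsupp.smul_apply,
          ih2 k (by simp only [Fin.lt_def, Fin.val_castSucc]; omega), smul_zero, sub_zero, hA]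
        refine Finset.sum_eq_zero fun j _ => ?_
        by_cases h : i.castSucc < j
        · rw [ih2 j h, mul_zero]
        · rw [ht.1, zero_mul]
          rw [not_lt, Fin.le_def] at h
          simp only [Fin.val_castSucc] at h
          rw [lt_abs]
          left
          omega
  have hdet : IsUnit (e.det w) := by
    rw [Module.Basis.det_apply, Matrix.det_of_isUpperTriangular, isUnit_iff_ne_zero,
      Finset.prod_ne_zero_iff]
    · exact fun i _ => (main i).1
    · intro i j hij
      exact (main j).2 i hij
  obtain ⟨hli, hsp⟩ := (Module.Basis.is_basis_iff_det e).2 hdet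
  refine ⟨Module.Basis.mk hli hsp.ge, e 0, ⟨e 0, ?_⟩, e.ne_zero 0, fun i => by simp [hw]⟩
  exact (Φ.idempotents_star 0).1 _ (Module.End.mem_eigenspace_iff.2 (he 0))

/-- A `Φ`-split basis of `V`. (It is unique up to a nonzero scalar factor common to all its
vectors, so matrices with respect to it do not depend on the choice.) -/
noncomputable def splitBasis (Φ : LeonardSystem F V d) : Module.Basis (Fin (d + 1)) F V :=
  Φ.exists_isSplitBasis.choose

theorem splitBasis_spec (Φ : LeonardSystem F V d) : Φ.IsSplitBasis Φ.splitBasis :=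
  Φ.exists_isSplitBasis.choose_spec

/-- The first split sequence `φ_1, …, φ_d` of `Φ`: the entry `(i - 1, i)` of the matrix representing
`Astar` with respect to a `Φ`-split basis. -/
noncomputable def varphi (Φ : LeonardSystem F V d) (i : ℕ) (hi : 1 ≤ i ∧ i ≤ d) : F :=
  LinearMap.toMatrix Φ.splitBasis Φ.splitBasis Φ.Astar ⟨i - 1, by omega⟩ ⟨i, by omega⟩

/-- The second split sequence of `Φ`: the first split sequence of `Φ^⇓`. -/
noncomputable def phi (Φ : LeonardSystem F V d) (i : ℕ) (hi : 1 ≤ i ∧ i ≤ d) : F :=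
  Φ.invert.varphi i hi

/-- The subspace `𝒳(Φ)` of the `X` in `End(V)` with `E i X E j = 0` and `Estar i X Estar j = 0`
whenever `|i - j| > 1`. -/
def spaceX (Φ : LeonardSystem F V d) : Submodule F (Module.End F V) where
  carrier := {X | ∀ i j : Fin (d + 1), 1 < |(i : ℤ) - (j : ℤ)| →
    Φ.E i * X * Φ.E j = 0 ∧ Φ.Estar i * X * Φ.Estar j = 0}
  zero_mem' := by intro i j _; simp
  add_mem' := by
    intro X Y hX hY i j hij
    simp [mul_add, add_mul, hX i j hij, hY i j hij]
  smul_mem' := by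
    intro c X hX i j hij
    simp [hX i j hij]

/-- `X` is an element of `𝒳(Φ)` that has zero diagonal. -/
def HasZeroDiagonal (Φ : LeonardSystem F V d) (X : Module.End F V) : Prop :=
  X ∈ Φ.spaceX ∧ ∀ i, Φ.Estar i * X * Φ.Estar i = 0

/-- The zero diagonal space `𝒵(Φ)`: the elements of `Span{I, Astar, A, A Astar}` that have zero
diagonal. -/
def zeroDiagonalSpace (Φ : LeonardSystem F V d) : Submodule F (Module.End F V) where
  carrier := {X | X ∈ Submodule.span F {1, Φ.Astar, Φ.A, Φ.A * Φ.Astar} ∧ Φ.HasZeroDiagonal X}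
  zero_mem' := ⟨zero_mem _, zero_mem _, by simp⟩
  add_mem' := by
    intro X Y hX hY
    exact ⟨add_mem hX.1 hY.1, add_mem hX.2.1 hY.2.1, fun i => by
      simp [mul_add, add_mul, hX.2.2 i, hY.2.2 i]⟩
  smul_mem' := by
    intro c X hX
    exact ⟨Submodule.smul_mem _ c hX.1, Submodule.smul_mem _ c hX.2.1, fun i => by
      simp [hX.2.2 i]⟩

/-- `Φ` has dual `q`-Krawtchouk type. Powers of `q` with possibly negative exponents are integer
powers. -/
def IsDualQKrawtchouk (Φ : LeonardSystem F V d) : Prop :=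
  ∃ q h hstar s : F,
    (q ≠ 0 ∧ h ≠ 0 ∧ hstar ≠ 0 ∧ s ≠ 0) ∧
    (∀ i : ℕ, 1 ≤ i → i ≤ d → q ^ i ≠ 1) ∧
    (∀ i : ℕ, 2 ≤ i → i ≤ 2 * d → s * q ^ i ≠ 1) ∧
    (∀ i : Fin (d + 1),
      Φ.θ i = Φ.θ 0 + h * (1 - q ^ (i : ℕ)) * (1 - s * q ^ ((i : ℕ) + 1)) * q ^ (-(i : ℤ)) ∧
      Φ.θstar i = Φ.θstar 0 + hstar * (1 - q ^ (i : ℕ)) * q ^ (-(i : ℤ))) ∧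
    (∀ (i : ℕ) (hi : 1 ≤ i ∧ i ≤ d),
      Φ.varphi i hi =
        h * hstar * q ^ (1 - 2 * (i : ℤ)) * (1 - q ^ i) * (1 - q ^ ((i : ℤ) - (d : ℤ) - 1)) ∧
      Φ.phi i hi =
        h * hstar * s * q ^ ((d : ℤ) + 2 - 2 * (i : ℤ)) * (1 - q ^ i) *
          (1 - q ^ ((i : ℤ) - (d : ℤ) - 1)))

/-- `Φ` has Hahn type. (The characteristic `ringChar F` of a field is `0` or a prime.) -/
def IsHahn (Φ : LeonardSystem F V d) : Prop :=
  ∃ hstar s sstar r : F,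
    (hstar ≠ 0 ∧ s ≠ 0) ∧
    (ringChar F = 0 ∨ d < ringChar F) ∧
    (∀ i : ℕ, 1 ≤ i → i ≤ d → r ≠ -(i : F) ∧ sstar - r ≠ -(i : F)) ∧
    (∀ i : ℕ, 2 ≤ i → i ≤ 2 * d → sstar ≠ -(i : F)) ∧
    (∀ i : Fin (d + 1),
      Φ.θ i = Φ.θ 0 + s * ((i : ℕ) : F) ∧
      Φ.θstar i = Φ.θstar 0 + hstar * ((i : ℕ) : F) * (((i : ℕ) : F) + 1 + sstar)) ∧
    (∀ (i : ℕ) (hi : 1 ≤ i ∧ i ≤ d),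
      Φ.varphi i hi = hstar * s * (i : F) * ((i : F) - (d : F) - 1) * ((i : F) + r) ∧
      Φ.phi i hi = -hstar * s * (i : F) * ((i : F) - (d : F) - 1) * ((i : F) + sstar - r))

/-- `Φ` has Krawtchouk type. -/
def IsKrawtchouk (Φ : LeonardSystem F V d) : Prop :=
  ∃ s sstar r : F,
    (s ≠ 0 ∧ sstar ≠ 0 ∧ r ≠ 0) ∧
    (ringChar F = 0 ∨ d < ringChar F) ∧
    r ≠ s * sstar ∧
    (∀ i : Fin (d + 1),
      Φ.θ i = Φ.θ 0 + s * ((i : ℕ) : F) ∧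
      Φ.θstar i = Φ.θstar 0 + sstar * ((i : ℕ) : F)) ∧
    (∀ (i : ℕ) (hi : 1 ≤ i ∧ i ≤ d),
      Φ.varphi i hi = r * (i : F) * ((i : F) - (d : F) - 1) ∧
      Φ.phi i hi = (r - s * sstar) * (i : F) * ((i : F) - (d : F) - 1))

end LeonardSystem

/-! Every X = α + β A* + γ A + δ A A* lies in 𝒳(Φ). In an eigenbasis of A* its matrix is that of A
with column j scaled by γ + δ θ*_j, plus a diagonal matrix; in an eigenbasis of A it is that of A*
with row i scaled by β + δ θ_i, plus a diagonal matrix. So only the zero diagonal matters: with a_i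
the diagonal entries of A in the eigenbasis of A*, it says α + β θ*_i + a_i (γ + δ θ*_i) = 0 for all
i. The theorem therefore asks that a_i be a fractional linear function of θ*_i, up to clearing
denominators (`zeroDiagonalSpace_ne_bot_of_relation`).

The a_i are expressed by the parameters through `exists_diagonal_eq`. The split basis is triangular
with respect to both eigenbases, and on it A is lower and A* upper bidiagonal; comparing
coefficients gives a_i. Each type then reduces to a polynomial identity in i or q^i. -/

/-! ### Flags defined by triangular bases -/

section TriangularBases

variable {F V ι : Type*} [Field F] [AddCommGroup V] [Module F V] [Fintype ι] [LinearOrder ι]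

/-- If a basis is triangular with respect to another one, its diagonal coefficients are nonzero. -/
theorem repr_self_ne_zero_of_triangular (e b : Module.Basis ι F V)
    (h : ∀ i k, i < k → e.repr (b i) k = 0) (i : ι) : e.repr (b i) i ≠ 0 := by
  have hu := e.isUnit_det b
  rw [Module.Basis.det_apply, Matrix.det_of_isUpperTriangular, isUnit_iff_ne_zero,
    Finset.prod_ne_zero_iff] at hu
  · exact hu i (Finset.mem_univ i)
  · intro k j hjk
    exact h j k hjk

/-- If a basis is triangular with respect to another one, both determine the same flag. -/
theorem repr_eq_zero_of_triangular (e b : Module.Basis ι F V)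
    (h : ∀ i k, i < k → e.repr (b i) k = 0) (v : V) (m : ι)
    (hv : ∀ k, m < k → e.repr v k = 0) : ∀ k, m < k → b.repr v k = 0 := by
  intro k
  -- Downward induction: once the `b`-coordinates beyond `k` vanish, triangularity leaves only the
  -- term of `b k` in the `k`-th `e`-coordinate.
  induction k using WellFoundedGT.induction with
  | ind k ih =>
    intro hk
    have hexp : e.repr v k = b.repr v k * e.repr (b k) k := by
      conv_lhs => rw [← b.sum_repr v]
      rw [map_sum, Finsupp.finsetSum_apply, Finset.sum_eq_single k]
      · simp
      · intro j _ hj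
        rcases lt_or_gt_of_ne hj with hlt | hgt
        · simp [h j k hlt]
        · simp [ih j hgt (hk.trans hgt)]
      · simp
    rw [hv k hk] at hexp
    exact (mul_eq_zero.1 hexp.symm).resolve_right (repr_self_ne_zero_of_triangular e b h k)

theorem repr_eq_zero_of_triangular_dual (e b : Module.Basis ι F V)
    (h : ∀ i k, k < i → e.repr (b i) k = 0) (v : V) (m : ι)
    (hv : ∀ k, k < m → e.repr v k = 0) : ∀ k, k < m → b.repr v k = 0 :=
  repr_eq_zero_of_triangular (ι := ιᵒᵈ) e b (fun i k hik => h i k hik) v m hv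

end TriangularBases

/-! ### Coordinates in an eigenbasis -/

section Eigenbases

variable {F V : Type*} [Field F] [AddCommGroup V] [Module F V] {d : ℕ}

theorem repr_apply_eq_sum {ι : Type*} [Fintype ι] [DecidableEq ι] (e : Module.Basis ι F V)
    (B : Module.End F V) (v : V) (k : ι) :
    e.repr (B v) k = ∑ j, LinearMap.toMatrix e e B k j * e.repr v j := by
  rw [← LinearMap.toMatrix_mulVec_repr e e B v]
  rfl

theorem repr_apply_of_eigenbasis {ι : Type*} [Fintype ι] [DecidableEq ι] (f : Module.Basis ι F V)
    {B : Module.End F V} {θ : ι → F} (hf : ∀ i, B (f i) = θ i • f i) (v : V) (k : ι) :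
    f.repr (B v) k = θ k * f.repr v k := by
  rw [repr_apply_eq_sum, Finset.sum_eq_single k]
  · simp [LinearMap.toMatrix_apply, hf]
  · intro j _ hj
    simp [LinearMap.toMatrix_apply, hf, hj.symm]
  · simp

theorem IsPrimitiveIdempotents.apply_eq {B : Module.End F V} {θ : Fin (d + 1) → F}
    {E : Fin (d + 1) → Module.End F V} (h : IsPrimitiveIdempotents B θ E)
    (f : Module.Basis (Fin (d + 1)) F V) (hf : ∀ i, B (f i) = θ i • f i) (i : Fin (d + 1)) (v : V) :
    E i v = f.repr v i • f i := by
  conv_lhs => rw [← f.sum_repr v]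
  rw [map_sum, Finset.sum_eq_single i]
  · rw [map_smul, (h i).1 _ (Module.End.mem_eigenspace_iff.2 (hf i))]
  · intro j _ hj
    rw [map_smul, (h i).2 j hj _ (Module.End.mem_eigenspace_iff.2 (hf j)), smul_zero]
  · simp

/-- The product `E i X E j` is determined by the `(i, j)` entry of `X` in an eigenbasis. -/
theorem IsPrimitiveIdempotents.mul_mul_eq_zero {B : Module.End F V} {θ : Fin (d + 1) → F}
    {E : Fin (d + 1) → Module.End F V} (h : IsPrimitiveIdempotents B θ E)
    (f : Module.Basis (Fin (d + 1)) F V) (hf : ∀ i, B (f i) = θ i • f i) (i j : Fin (d + 1))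
    (X : Module.End F V) (hX : f.repr (X (f j)) i = 0) : E i * X * E j = 0 := by
  ext v
  simp [h.apply_eq f hf, hX]

end Eigenbases

/-! ### Bidiagonal action of A and A* on the split basis -/

namespace LeonardSystem

variable {F V : Type*} [Field F] [AddCommGroup V] [Module F V] {d : ℕ}

theorem IsSplitBasis.apply_castSucc {Φ : LeonardSystem F V d}
    {b : Module.Basis (Fin (d + 1)) F V} (hb : Φ.IsSplitBasis b) (i : Fin d) :
    Φ.A (b i.castSucc) = Φ.θ i.castSucc • b i.castSucc + b i.succ := by
  obtain ⟨u, -, -, hu⟩ := hb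
  have h1 : Finset.Iio i.succ = insert i.castSucc (Finset.Iio i.castSucc) := by
    ext j
    simp only [Finset.mem_Iio, Finset.mem_insert, Fin.lt_def, Fin.ext_iff, Fin.val_succ,
      Fin.val_castSucc]
    omega
  rw [hu, hu, tauPoly, tauPoly, h1, Finset.prod_insert (by simp)]
  simp [sub_mul, Algebra.algebraMap_eq_smul_one]

/-- The split basis is upper triangular with respect to an eigenbasis of `Astar`. -/
theorem IsSplitBasis.repr_star_eq_zero {Φ : LeonardSystem F V d}
    {b : Module.Basis (Fin (d + 1)) F V} (hb : Φ.IsSplitBasis b)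
    (e : Module.Basis (Fin (d + 1)) F V) (he : ∀ i, Φ.Astar (e i) = Φ.θstar i • e i)
    (ht : IsIrreducibleTridiagonal (LinearMap.toMatrix e e Φ.A)) (i : Fin (d + 1)) :
    ∀ k, i < k → e.repr (b i) k = 0 := by
  induction i using Fin.induction with
  | zero =>
    intro k hk
    obtain ⟨u, ⟨w, hw⟩, -, hu⟩ := hb
    have h0 : b 0 = u := by
      have : Finset.Iio (0 : Fin (d + 1)) = ∅ := by ext j; simp
      simp [hu, tauPoly, this]
    rw [h0, ← hw, Φ.idempotents_star.apply_eq e he]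
    simp [hk.ne]
  | succ i ih =>
    intro k hk
    have hk' : (i : ℕ) + 1 < k := by simpa [Fin.lt_def] using hk
    -- b_{i+1} = (A - θ_i) b_i, and the tridiagonal A extends the support in `e` by at most one
    -- index.
    rw [← sub_eq_of_eq_add' (hb.apply_castSucc i), map_sub, map_smul, Finsupp.sub_apply,
      Finsupp.smul_apply, ih k (by simp only [Fin.lt_def, Fin.val_castSucc]; omega), smul_zero,
      sub_zero, repr_apply_eq_sum]
    refine Finset.sum_eq_zero fun j _ => ?_
    by_cases h : i.castSucc < j
    · rw [ih j h, mul_zero]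
    · rw [ht.1, zero_mul]
      rw [not_lt, Fin.le_def] at h
      simp only [Fin.val_castSucc] at h
      rw [lt_abs]
      left
      omega

/-- The split basis is lower triangular with respect to an eigenbasis of `A`. -/
theorem IsSplitBasis.repr_eq_zero {Φ : LeonardSystem F V d}
    {b : Module.Basis (Fin (d + 1)) F V} (hb : Φ.IsSplitBasis b)
    (f : Module.Basis (Fin (d + 1)) F V) (hf : ∀ i, Φ.A (f i) = Φ.θ i • f i)
    (i : Fin (d + 1)) : ∀ k, k < i → f.repr (b i) k = 0 := by
  induction i using Fin.induction with
  | zero => intro k hk; simp at hk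
  | succ i ih =>
    intro k hk
    rw [← sub_eq_of_eq_add' (hb.apply_castSucc i), map_sub, map_smul, Finsupp.sub_apply,
      Finsupp.smul_apply, repr_apply_of_eigenbasis f hf]
    -- The factor A - θ_i kills exactly the coordinate at i, the first one not already zero by
    -- induction.
    rcases (Fin.le_castSucc_iff.2 hk).eq_or_lt with h | h
    · rw [h]; simp
    · rw [ih k h]; simp

/-- By triangularity the last split vector has no coordinate other than the last in an eigenbasis of
A. -/
theorem IsSplitBasis.apply_last {Φ : LeonardSystem F V d}
    {b : Module.Basis (Fin (d + 1)) F V} (hb : Φ.IsSplitBasis b) :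
    Φ.A (b (Fin.last d)) = Φ.θ (Fin.last d) • b (Fin.last d) := by
  obtain ⟨f, hf, -⟩ := Φ.standard.exists_basis
  apply f.repr.injective
  ext k
  rw [repr_apply_of_eigenbasis f hf, map_smul, Finsupp.smul_apply, smul_eq_mul]
  rcases (Fin.le_last k).eq_or_lt with h | h
  · rw [h]
  · simp [hb.repr_eq_zero f hf _ k h]

/-- The action of `Astar` on the split basis. -/
theorem splitBasis_star_apply_succ (Φ : LeonardSystem F V d) (i : Fin d) :
    Φ.Astar (Φ.splitBasis i.succ) = Φ.θstar i.succ • Φ.splitBasis i.succ +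
      Φ.varphi (i + 1) ⟨by omega, by omega⟩ • Φ.splitBasis i.castSucc := by
  have hb := Φ.splitBasis_spec
  obtain ⟨e, he, hte⟩ := Φ.standard_star.exists_basis
  obtain ⟨f, hf, htf⟩ := Φ.standard.exists_basis
  set b := Φ.splitBasis with hbdef
  have hphi : Φ.varphi (i + 1) ⟨by omega, by omega⟩ = b.repr (Φ.Astar (b i.succ)) i.castSucc := by
    rw [varphi, LinearMap.toMatrix_apply]
    rfl
  -- A* - θ*_{i+1} removes the top term of b_{i+1} in `e`, so the result lies in the span of e_0, …,
  -- e_i, which is that of b_0, …, b_i.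
  have hup : ∀ k, i.castSucc < k →
      b.repr (Φ.Astar (b i.succ) - Φ.θstar i.succ • b i.succ) k = 0 := by
    refine repr_eq_zero_of_triangular e b (hb.repr_star_eq_zero e he hte) _ _ fun k hk => ?_
    rw [map_sub, map_smul, Finsupp.sub_apply, Finsupp.smul_apply, repr_apply_of_eigenbasis e he,
      smul_eq_mul]
    rcases (Fin.castSucc_lt_iff_succ_le.1 hk).eq_or_lt with h | h
    · rw [h, sub_self]
    · rw [hb.repr_star_eq_zero e he hte _ k h]; simp
  -- From below: b_{i+1} lies in the span of f_{i+1}, …, f_d, and A*, tridiagonal in `f`, lowers the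
  -- index by at most one.
  have hlow : ∀ k, k < i.castSucc → b.repr (Φ.Astar (b i.succ)) k = 0 := by
    refine repr_eq_zero_of_triangular_dual f b (hb.repr_eq_zero f hf) _ _ fun k hk => ?_
    rw [repr_apply_eq_sum]
    refine Finset.sum_eq_zero fun j _ => ?_
    by_cases h : j < i.succ
    · rw [hb.repr_eq_zero f hf _ j h, mul_zero]
    · rw [htf.1, zero_mul]
      simp only [not_lt, Fin.lt_def, Fin.val_succ, Fin.val_castSucc] at h hk
      rw [lt_abs]
      right
      omega
  apply b.repr.injective
  ext k
  rw [hphi]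
  rcases lt_trichotomy k i.castSucc with h | h | h
  · have h' : i.succ ≠ k := by
      simp only [Fin.lt_def, Fin.val_castSucc] at h
      simp only [ne_eq, Fin.ext_iff, Fin.val_succ]
      omega
    simp [hlow k h, h'.symm, h.ne]
  · have h' : i.succ ≠ i.castSucc := by simp [Fin.ext_iff]
    subst h
    simp [h'.symm]
  · have := hup k h
    rw [map_sub, Finsupp.sub_apply, sub_eq_zero] at this
    simp [this, h.ne']

/-- The diagonal entries of `A` in an eigenbasis of `Astar` in terms of the first split sequence:
`a i = θ i + varphi i / (θstar i - θstar (i - 1)) + varphi (i + 1) / (θstar i - θstar (i + 1))`,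
where the terms that make no sense are omitted. -/
theorem exists_diagonal_eq (Φ : LeonardSystem F V d) (e : Module.Basis (Fin (d + 1)) F V)
    (he : ∀ i, Φ.Astar (e i) = Φ.θstar i • e i)
    (ht : IsIrreducibleTridiagonal (LinearMap.toMatrix e e Φ.A)) (i : Fin (d + 1)) :
    ∃ x y : F, LinearMap.toMatrix e e Φ.A i i = Φ.θ i + x + y ∧
      (∀ _ : (i : ℕ) = 0, x = 0) ∧
      (∀ h : 1 ≤ (i : ℕ) ∧ (i : ℕ) ≤ d,
        x * (Φ.θstar i - Φ.θstar ⟨i - 1, by omega⟩) = Φ.varphi i h) ∧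
      (∀ _ : (i : ℕ) = d, y = 0) ∧
      (∀ h : 1 ≤ (i : ℕ) + 1 ∧ (i : ℕ) + 1 ≤ d,
        y * (Φ.θstar i - Φ.θstar ⟨i + 1, by omega⟩) = Φ.varphi (i + 1) h) := by
  have hb := Φ.splitBasis_spec
  have hst := Φ.splitBasis_star_apply_succ
  set b := Φ.splitBasis
  have htri := hb.repr_star_eq_zero e he ht
  have hne := repr_self_ne_zero_of_triangular e b htri
  -- comparison of the coefficients of `A (b i)` below the diagonal
  have hsub : ∀ j : Fin d, e.repr (b j.succ) j.succ =
      LinearMap.toMatrix e e Φ.A j.succ j.castSucc * e.repr (b j.castSucc) j.castSucc := by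
    intro j
    have h1 := congrArg (fun v => e.repr v j.succ) (hb.apply_castSucc j)
    simp only [map_add, map_smul, Finsupp.add_apply, Finsupp.smul_apply] at h1
    rw [htri j.castSucc j.succ (by simp [Fin.lt_def]), smul_zero, zero_add,
      repr_apply_eq_sum, Finset.sum_eq_single j.castSucc] at h1
    · exact h1.symm
    · intro k _ hk
      rcases lt_or_gt_of_ne hk with h | h
      · rw [ht.1, zero_mul]
        simp only [Fin.lt_def, Fin.val_castSucc] at h
        rw [lt_abs]
        left
        simp only [Fin.val_succ]
        omega
      · rw [htri _ k h, mul_zero]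
    · simp
  -- The coefficient of e_j in A* b_{j+1}, computed in the two bases.
  have hsup : ∀ j : Fin d, e.repr (b j.succ) j.castSucc *
      (Φ.θstar j.castSucc - Φ.θstar j.succ) =
      Φ.varphi (j + 1) ⟨by omega, by omega⟩ * e.repr (b j.castSucc) j.castSucc := by
    intro j
    have h1 := congrArg (fun v => e.repr v j.castSucc) (hst j)
    simp only [map_add, map_smul, Finsupp.add_apply, Finsupp.smul_apply,
      repr_apply_of_eigenbasis e he, smul_eq_mul] at h1
    linear_combination h1
  -- The e_i-coefficient of A b_i is computed twice. Here A b_i = θ_i b_i + b_{i+1} is used, and y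
  -- comes from b_{i+1}.
  have hy : ∃ y : F, e.repr (Φ.A (b i)) i = (Φ.θ i + y) * e.repr (b i) i ∧
      (∀ _ : (i : ℕ) = d, y = 0) ∧
      (∀ h : 1 ≤ (i : ℕ) + 1 ∧ (i : ℕ) + 1 ≤ d,
        y * (Φ.θstar i - Φ.θstar ⟨i + 1, by omega⟩) = Φ.varphi (i + 1) h) := by
    induction i using Fin.lastCases with
    | last =>
      refine ⟨0, by simp [hb.apply_last], fun _ => rfl, fun h => absurd h.2 (by simp)⟩
    | cast j =>
      refine ⟨e.repr (b j.succ) j.castSucc / e.repr (b j.castSucc) j.castSucc, ?_,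
        fun h => absurd h (by simp; omega), fun h => ?_⟩
      · rw [hb.apply_castSucc, add_mul, div_mul_cancel₀ _ (hne _)]
        simp
      · rw [div_mul_eq_mul_div, div_eq_iff (hne _)]
        exact hsup j
  -- Now the matrix of A in `e` is used: besides the diagonal entry only the subdiagonal one
  -- contributes, and it gives -x.
  have hx : ∃ x : F, e.repr (Φ.A (b i)) i = (LinearMap.toMatrix e e Φ.A i i - x) * e.repr (b i) i ∧
      (∀ _ : (i : ℕ) = 0, x = 0) ∧
      (∀ h : 1 ≤ (i : ℕ) ∧ (i : ℕ) ≤ d,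
        x * (Φ.θstar i - Φ.θstar ⟨i - 1, by omega⟩) = Φ.varphi i h) := by
    clear hy
    induction i using Fin.cases with
    | zero =>
      refine ⟨0, ?_, fun _ => rfl, fun h => absurd h.1 (by simp)⟩
      rw [repr_apply_eq_sum, Finset.sum_eq_single 0, sub_zero]
      · intro k _ hk
        rw [htri 0 k (Fin.pos_iff_ne_zero.2 hk), mul_zero]
      · simp
    | succ j =>
      refine ⟨-(LinearMap.toMatrix e e Φ.A j.succ j.castSucc * e.repr (b j.succ) j.castSucc / e.repr (b j.succ) j.succ), ?_,
        fun h => absurd h (by simp), fun h => ?_⟩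
      · have hjs : j.castSucc ≠ j.succ := by simp [Fin.ext_iff]
        rw [sub_neg_eq_add, add_mul, div_mul_cancel₀ _ (hne _), repr_apply_eq_sum,
          Finset.sum_eq_add j.succ j.castSucc hjs.symm]
        · intro k _ hk
          by_cases h : j.succ < k
          · rw [htri _ k h, mul_zero]
          · rw [ht.1, zero_mul]
            obtain ⟨h1, h2⟩ := hk
            simp only [Fin.lt_def, Fin.val_succ, ne_eq, Fin.ext_iff, Fin.val_castSucc] at h h1 h2
            rw [lt_abs]
            left
            simp only [Fin.val_succ]
            omega
        · simp
        · simp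
      · have h1 := hsup j
        have h2 := hsub j
        have h3 := hne j.succ
        have h4 := hne j.castSucc
        have h5 : LinearMap.toMatrix e e Φ.A j.succ j.castSucc ≠ 0 := ht.2 _ _ (by simp)
        change _ * (Φ.θstar j.succ - Φ.θstar j.castSucc) = Φ.varphi (j + 1) _
        rw [h2]
        field_simp
        linear_combination h1
  obtain ⟨x, hx1, hx2, hx3⟩ := hx
  obtain ⟨y, hy1, hy2, hy3⟩ := hy
  refine ⟨x, y, ?_, hx2, hx3, hy2, hy3⟩
  have := mul_right_cancel₀ (hne i) (hx1.symm.trans hy1)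
  linear_combination this

/-- A linear dependence between `1`, `θstar`, the diagonal `a` of `A` and `a θstar` produces a
nonzero element of the zero diagonal space. -/
theorem zeroDiagonalSpace_ne_bot_of_relation (hd : 1 ≤ d) (Φ : LeonardSystem F V d)
    (e : Module.Basis (Fin (d + 1)) F V) (he : ∀ i, Φ.Astar (e i) = Φ.θstar i • e i)
    (ht : IsIrreducibleTridiagonal (LinearMap.toMatrix e e Φ.A))
    (α β γ δ : F)
    (hrel : ∀ i, α + β * Φ.θstar i + LinearMap.toMatrix e e Φ.A i i * (γ + δ * Φ.θstar i) = 0)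
    (hne : γ ≠ 0 ∨ δ ≠ 0) : Φ.zeroDiagonalSpace ≠ ⊥ := by
  obtain ⟨f, hf, htf⟩ := Φ.standard.exists_basis
  set X : Module.End F V := α • 1 + β • Φ.Astar + γ • Φ.A + δ • (Φ.A * Φ.Astar) with hXdef
  have hXe : ∀ i j, e.repr (X (e j)) i = (if j = i then α + β * Φ.θstar j else 0) +
      LinearMap.toMatrix e e Φ.A i j * (γ + δ * Φ.θstar j) := by
    intro i j
    simp only [hXdef, LinearMap.add_apply, LinearMap.smul_apply, Module.End.one_apply,
      Module.End.mul_apply, he, map_add, map_smul, Finsupp.add_apply, Finsupp.smul_apply,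
      Module.Basis.repr_self, Finsupp.single_apply, LinearMap.toMatrix_apply, smul_eq_mul]
    split_ifs <;> ring
  have hXf : ∀ i j, f.repr (X (f j)) i = (if j = i then α + γ * Φ.θ j else 0) +
      LinearMap.toMatrix f f Φ.Astar i j * (β + δ * Φ.θ i) := by
    intro i j
    simp only [hXdef, LinearMap.add_apply, LinearMap.smul_apply, Module.End.one_apply,
      Module.End.mul_apply, hf, map_add, map_smul, Finsupp.add_apply, Finsupp.smul_apply,
      Module.Basis.repr_self, Finsupp.single_apply, LinearMap.toMatrix_apply, smul_eq_mul,
      repr_apply_of_eigenbasis f hf]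
    split_ifs <;> ring
  have hmem : X ∈ Φ.zeroDiagonalSpace := by
    refine ⟨?_, fun i j hij => ?_, fun i => ?_⟩
    · refine add_mem (add_mem (add_mem ?_ ?_) ?_) ?_ <;>
        exact Submodule.smul_mem _ _ (Submodule.subset_span (by simp))
    · have hji : j ≠ i := by
        rintro rfl
        simp at hij
      exact ⟨Φ.idempotents.mul_mul_eq_zero f hf i j X (by rw [hXf, htf.1 i j hij]; simp [hji]),
        Φ.idempotents_star.mul_mul_eq_zero e he i j X (by rw [hXe, ht.1 i j hij]; simp [hji])⟩
    · exact Φ.idempotents_star.mul_mul_eq_zero e he i i X (by rw [hXe, if_pos rfl, hrel])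
  intro hbot
  have hX0 : X = 0 := by rwa [hbot, Submodule.mem_bot] at hmem
  -- If X = 0, the nonzero off-diagonal entries of A force γ + δ θ*_j = 0. Since θ*_0 ≠ θ*_1, the
  -- columns 0 and 1 then give γ = δ = 0.
  have hzero : ∀ i j : Fin (d + 1), |(i : ℤ) - (j : ℤ)| = 1 → γ + δ * Φ.θstar j = 0 := by
    intro i j hij
    have h1 := hXe i j
    have hji : j ≠ i := by
      rintro rfl
      simp at hij
    rw [hX0, if_neg hji] at h1
    simp only [LinearMap.zero_apply, map_zero, Finsupp.zero_apply, zero_add] at h1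
    exact (mul_eq_zero.1 h1.symm).resolve_left (ht.2 i j hij)
  have h0 := hzero ⟨1, by omega⟩ ⟨0, by omega⟩ (by simp)
  have h1 := hzero ⟨0, by omega⟩ ⟨1, by omega⟩ (by simp)
  have hθ : Φ.θstar ⟨0, by omega⟩ - Φ.θstar ⟨1, by omega⟩ ≠ 0 :=
    sub_ne_zero.2 fun h => absurd (Φ.standard_star.injective h) (by simp)
  have hδ : δ = 0 := by
    have : δ * (Φ.θstar ⟨0, by omega⟩ - Φ.θstar ⟨1, by omega⟩) = 0 := by
      linear_combination h0 - h1
    exact (mul_eq_zero.1 this).resolve_right hθ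
  rw [hδ] at h0
  exact hne.elim (fun h => h (by simpa using h0)) (fun h => h hδ)

/-! ### The three types -/

/-- The quadratic terms in i cancel: t a_i = t θ_0 + r d + (s t - 2 r) i, where t i = θ*_i - θ*_0.
Thus a_i is affine in θ*_i and δ = 0 suffices. -/
theorem IsKrawtchouk.zeroDiagonalSpace_ne_bot (hd : 1 ≤ d) {Φ : LeonardSystem F V d}
    (hΦ : Φ.IsKrawtchouk) : Φ.zeroDiagonalSpace ≠ ⊥ := by
  obtain ⟨s, t, r, ⟨-, ht0, -⟩, -, -, hθ, hφ⟩ := hΦ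
  obtain ⟨e, he, ht⟩ := Φ.standard_star.exists_basis
  refine Φ.zeroDiagonalSpace_ne_bot_of_relation hd e he ht
    (-(t * Φ.θ 0 + r * d - (s * t - 2 * r) * Φ.θstar 0 / t)) (-(s * t - 2 * r) / t) t 0
    (fun i => ?_) (Or.inl ht0)
  obtain ⟨x, y, ha, hx0, hx, hy0, hy⟩ := Φ.exists_diagonal_eq e he ht i
  -- The right-hand sides of this relation and the next vanish at i = 0 and i = d respectively, so
  -- both ends fit the general formula.
  have hx' : x * t = r * (i : ℕ) * ((i : ℕ) - d - 1) := by
    by_cases h : (i : ℕ) = 0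
    · simp [hx0 h, h]
    · have h1 := hx ⟨by omega, by omega⟩
      rw [(hφ _ _).1, (hθ i).2, (hθ ⟨i - 1, by omega⟩).2] at h1
      simp only [Nat.cast_sub (Nat.one_le_iff_ne_zero.2 h), Nat.cast_one] at h1
      linear_combination h1
  have hy' : y * t = -(r * ((i : ℕ) + 1) * ((i : ℕ) - d)) := by
    by_cases h : (i : ℕ) = d
    · simp [hy0 h, h]
    · have h1 := hy ⟨by omega, by omega⟩
      rw [(hφ _ _).1, (hθ i).2, (hθ ⟨i + 1, by omega⟩).2] at h1
      push_cast at h1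
      linear_combination -h1
  rw [ha, (hθ i).1, (hθ i).2]
  field_simp
  linear_combination t * hx' + t * hy'

/-- The two differences of dual eigenvalues contribute the denominators 2i + t and 2i + 2 + t. Their
product is 4 i (i + 1 + t) + t (t + 2), and c times it is γ + δ θ*_i with δ = 4. After
multiplication by it, the terms of degree above 2 in i cancel and the rest is affine in θ*_i. -/
theorem IsHahn.zeroDiagonalSpace_ne_bot (hd : 2 ≤ d) {Φ : LeonardSystem F V d}
    (hΦ : Φ.IsHahn) : Φ.zeroDiagonalSpace ≠ ⊥ := by
  obtain ⟨c, s, t, r, ⟨hc, -⟩, hchar, -, -, hθ, hφ⟩ := hΦ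
  obtain ⟨e, he, ht⟩ := Φ.standard_star.exists_basis
  have h2 : (2 : F) ≠ 0 := by
    intro h
    have hdvd : ringChar F ∣ 2 := ringChar.dvd (by exact_mod_cast h)
    rcases hchar with h0 | h0
    · rw [h0] at hdvd
      simp at hdvd
    · have := Nat.le_of_dvd two_pos hdvd
      omega
  have h4 : (4 : F) ≠ 0 := by
    have : (4 : F) = 2 * 2 := by norm_num
    rw [this]
    exact mul_ne_zero h2 h2
  refine Φ.zeroDiagonalSpace_ne_bot_of_relation (by omega) e he ht
    (-(Φ.θ 0 * (c * t * (t + 2) - 4 * Φ.θstar 0) +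
      s * (c * d * (1 + r) * t - (2 * d - 2 * r + t) * Φ.θstar 0)))
    (-(4 * Φ.θ 0 + s * (2 * d - 2 * r + t))) (c * t * (t + 2) - 4 * Φ.θstar 0) 4
    (fun i => ?_) (Or.inr h4)
  obtain ⟨x, y, ha, hx0, hx, hy0, hy⟩ := Φ.exists_diagonal_eq e he ht i
  -- No division here: 2i + t may vanish at i = 0, and 2i + 2 + t at i = d, where x and y
  -- respectively are zero anyway.
  have hx' : x * (2 * (i : ℕ) + t) = s * (i : ℕ) * ((i : ℕ) - d - 1) * ((i : ℕ) + r) := by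
    by_cases h : (i : ℕ) = 0
    · simp [hx0 h, h]
    · have h1 := hx ⟨by omega, by omega⟩
      rw [(hφ _ _).1, (hθ i).2, (hθ ⟨i - 1, by omega⟩).2] at h1
      simp only [Nat.cast_sub (Nat.one_le_iff_ne_zero.2 h), Nat.cast_one] at h1
      apply mul_left_cancel₀ hc
      linear_combination h1
  have hy' : y * (2 * (i : ℕ) + 2 + t) =
      -(s * ((i : ℕ) + 1) * ((i : ℕ) - d) * ((i : ℕ) + 1 + r)) := by
    by_cases h : (i : ℕ) = d
    · simp [hy0 h, h]
    · have h1 := hy ⟨by omega, by omega⟩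
      rw [(hφ _ _).1, (hθ i).2, (hθ ⟨i + 1, by omega⟩).2] at h1
      push_cast at h1
      apply mul_left_cancel₀ hc
      linear_combination -h1
  rw [ha, (hθ i).1, (hθ i).2]
  linear_combination c * (2 * (i : ℕ) + 2 + t) * hx' + c * (2 * (i : ℕ) + t) * hy'

/-- The terms in q^{-i} cancel: a_i = (θ_0 - h - h s q) + h (s q + q^{-d}) q^i. Since θ*_i - θ*_0 +
c = c q^{-i}, multiplying a_i by this quantity gives an affine function of θ*_i. -/
theorem IsDualQKrawtchouk.zeroDiagonalSpace_ne_bot (hd : 1 ≤ d) {Φ : LeonardSystem F V d}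
    (hΦ : Φ.IsDualQKrawtchouk) : Φ.zeroDiagonalSpace ≠ ⊥ := by
  obtain ⟨q, h, c, s, ⟨hq, -, hc, -⟩, hq1, -, hθ, hφ⟩ := hΦ
  obtain ⟨e, he, ht⟩ := Φ.standard_star.exists_basis
  have hq1' : 1 - q ≠ 0 := by
    rw [sub_ne_zero]
    intro h1
    exact hq1 1 le_rfl hd (by simp [← h1])
  refine Φ.zeroDiagonalSpace_ne_bot_of_relation hd e he ht
    (-((Φ.θ 0 - h - h * s * q) * (c - Φ.θstar 0) + h * c * (s * q + (q ^ d)⁻¹)))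
    (-(Φ.θ 0 - h - h * s * q)) (c - Φ.θstar 0) 1
    (fun i => ?_) (Or.inr one_ne_zero)
  obtain ⟨x, y, ha, hx0, hx, hy0, hy⟩ := Φ.exists_diagonal_eq e he ht i
  have hQ : q ^ (i : ℕ) ≠ 0 := pow_ne_zero _ hq
  have hD : q ^ d ≠ 0 := pow_ne_zero _ hq
  have hx' : x * (1 - q) * q ^ (i : ℕ) * (q ^ d * q) =
      h * q * (1 - q ^ (i : ℕ)) * (q ^ d * q - q ^ (i : ℕ)) := by
    by_cases h0 : (i : ℕ) = 0
    · simp [hx0 h0, h0]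
    · have h1 := hx ⟨by omega, by omega⟩
      obtain ⟨j, hj⟩ := Nat.exists_eq_succ_of_ne_zero h0
      rw [(hφ _ _).1, (hθ i).2, (hθ ⟨i - 1, by omega⟩).2] at h1
      simp only [hj, Nat.succ_sub_one, Nat.succ_eq_add_one] at h1 hQ ⊢
      have e1 : q ^ (1 - 2 * ((j + 1 : ℕ) : ℤ)) = q / (q ^ (j + 1)) ^ 2 := by
        rw [zpow_sub₀ hq, zpow_one, mul_comm, zpow_mul, zpow_natCast, zpow_ofNat]
      have e2 : q ^ (((j + 1 : ℕ) : ℤ) - d - 1) = q ^ (j + 1) / (q ^ d * q) := by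
        rw [zpow_sub₀ hq, zpow_sub₀ hq, zpow_one, zpow_natCast, zpow_natCast, div_div]
      rw [e1, e2, zpow_neg, zpow_neg, zpow_natCast, zpow_natCast, pow_succ] at h1
      have hJ : q ^ j ≠ 0 := pow_ne_zero _ hq
      rw [pow_succ]
      generalize q ^ j = J at *
      generalize q ^ d = D at *
      field_simp at h1
      apply mul_left_cancel₀ hc
      linear_combination q ^ 2 * h1
  have hy' : y * (1 - q) * q ^ (i : ℕ) * q ^ d =
      -(h * (1 - q ^ (i : ℕ) * q) * (q ^ d - q ^ (i : ℕ))) := by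
    by_cases h0 : (i : ℕ) = d
    · simp [hy0 h0, h0]
    · have h1 := hy ⟨by omega, by omega⟩
      rw [(hφ _ _).1, (hθ i).2, (hθ ⟨i + 1, by omega⟩).2] at h1
      have e1 : q ^ (1 - 2 * (((i : ℕ) + 1 : ℕ) : ℤ)) = q / (q ^ ((i : ℕ) + 1)) ^ 2 := by
        rw [zpow_sub₀ hq, zpow_one, mul_comm, zpow_mul, zpow_natCast, zpow_ofNat]
      have e2 : q ^ ((((i : ℕ) + 1 : ℕ) : ℤ) - d - 1) = q ^ ((i : ℕ) + 1) / (q ^ d * q) := by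
        rw [zpow_sub₀ hq, zpow_sub₀ hq, zpow_one, zpow_natCast, zpow_natCast, div_div]
      rw [e1, e2, zpow_neg, zpow_neg, zpow_natCast, zpow_natCast, pow_succ] at h1
      generalize q ^ (i : ℕ) = J at *
      generalize q ^ d = D at *
      field_simp at h1
      apply mul_left_cancel₀ hc
      linear_combination -h1
  rw [ha, (hθ i).1, (hθ i).2, zpow_neg, zpow_natCast, pow_succ]
  generalize q ^ (i : ℕ) = J at *
  generalize q ^ d = D at *
  -- Only the sum is needed; its numerator contains the factor 1 - q, which cancels the common
  -- denominator.
  have hxy : x + y = h * (J / D - J⁻¹) := by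
    have hxy' : (x + y) * (1 - q) * J * D * q = h * (J ^ 2 - D) * (1 - q) * q := by
      linear_combination hx' + q * hy'
    field_simp
    apply mul_right_cancel₀ (mul_ne_zero hq1' hq)
    linear_combination hxy'
  rw [eq_sub_of_add_eq hxy]
  field_simp
  ring

end LeonardSystem

theorem theorem9p1 {F V : Type*} [Field F] [IsAlgClosed F] [AddCommGroup V] [Module F V]
    {d : ℕ} (hd : 3 ≤ d) (Φ : LeonardSystem F V d)
    (hΦ : Φ.IsDualQKrawtchouk ∨ Φ.IsHahn ∨ Φ.IsKrawtchouk) :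
    Φ.zeroDiagonalSpace ≠ ⊥ := by
  rcases hΦ with h | h | h
  · exact h.zeroDiagonalSpace_ne_bot (by omega)
  · exact h.zeroDiagonalSpace_ne_bot (by omega)
  · exact h.zeroDiagonalSpace_ne_bot (by omega)
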